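/- Let $K,N,N_r,M,S$ be nonnegative integers with $N_r\le N$, $N-N_r<M<N$ and $N-N_r+2\le S\le N$, and put $$n=\Big(\tbinom NS-\tbinom MS\Big)N_r-\tbinom NS(N-M),\qquad R=\frac{\binom NS-\binom MS}{n}$$ (with $\binom MS=0$ if $S>M$). Consider the following secure gradient coding problem with uncoded groupwise keys. There are gradients $g_1,\dots,g_K\in\mathbb F_q^L$, mutually independent random vectors with arbitrary laws, and dataset $k$ is held by the servers in a set $\mathcal D_k\subseteq[N]$. Every group $\mathcal V\subseteq[N]$ of $S$ servers shares a uniformly distributed key $Q_{\mathcal V}\in\mathbb F_q^{\ell}$; the keys and the gradients are all mutually independent. A linear scheme consists of a key length $\ell$ and, for each server $i\in[N]$, a message $X_i$ of $\ell_i$ symbols of $\mathbb F_q$ that is an $\mathbb F_q$-linear function of the gradients and keys. It is required that, whatever the laws of the gradients, 1. (encodability) $H\big(X_i\mid (g_k: i\in\mathcal D_k),(Q_{\mathcal V}: i\in\mathcal V)\big)=0$ for every $i\in[N]$; 2. (decodability) $H\big(\sum_k g_k\mid (X_i:i\in\mathcal U)\big)=0$ for every $\mathcal U\subseteq[N]$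 with $|\mathcal U|=N_r$; 3. (security) $I\big(X_1,\dots,X_N;g_1,\dots,g_K\mid \sum_k g_k\big)=0$. The communication cost of the scheme is $\max_i \ell_i/L$. Then the communication cost $R$ is achievable for every data assignment in which each dataset is held by at least $M$ servers. More precisely, there is $q_0$, depending only on $K,N,N_r,M,S$, such that for every finite field $\mathbb F_q$, every integer $m\ge1$ with $q^m\ge q_0$, and every assignment $(\mathcal D_k)_{k\in[K]}$ with $|\mathcal D_k|\ge M$ for all $k$, the number $L=mn$ is positive and there is a linear scheme over $\mathbb F_q$ for gradients in $\mathbb F_q^{L}$ that satisfies 1, 2 and 3 and has communication cost exactly $R$. (So if $q\ge q_0$ every positive multiple $L$ of $n$ is possible, and for an arbitrary field every sufficiently large multiple of $n$.) -/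

import Mathlib

universe u v w

namespace SecureGradientCoding

open MeasureTheory ProbabilityTheory

section Entropy

/-- Shannon entropy, in base `b`, of a random variable `X` with finitely many values
(with the convention `0 * log 0 = 0`). -/
noncomputable def entropy {Ω : Type w} {α : Type v} [MeasurableSpace Ω] [Fintype α]
    (b : ℝ) (μ : Measure Ω) (X : Ω → α) : ℝ :=
  ∑ x : α, -(μ.real (X ⁻¹' {x}) * Real.logb b (μ.real (X ⁻¹' {x})))

/-- Conditional entropy `H(X | Y) = H(X, Y) - H(Y)`. -/
noncomputable def condEntropy {Ω : Type w} {α : Type u} {β : Type v} [MeasurableSpace Ω]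
    [Fintype α] [Fintype β] (b : ℝ) (μ : Measure Ω) (X : Ω → α) (Y : Ω → β) : ℝ :=
  entropy b μ (fun ω => (X ω, Y ω)) - entropy b μ Y

/-- Conditional mutual information `I(X ; Y | Z) = H(X | Z) - H(X | Y, Z)`. -/
noncomputable def condMutualInfo {Ω : Type w} {α β γ : Type u} [MeasurableSpace Ω]
    [Fintype α] [Fintype β] [Fintype γ] (b : ℝ) (μ : Measure Ω)
    (X : Ω → α) (Y : Ω → β) (Z : Ω → γ) : ℝ :=
  condEntropy b μ X Z - condEntropy b μ X (fun ω => (Y ω, Z ω))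

end Entropy

/-- The groups of `S` servers among `N` servers; each group shares one key. -/
abbrev KeyGroup (N S : ℕ) : Type := {V : Finset (Fin N) // V.card = S}

/-- A linear coding scheme over `F` for `K` gradients in `F ^ L`, `N` servers and one key in
`F ^ keyLen` for each group of `S` servers. The message of server `n` consists of `msgLen n`
symbols of `F` and is an `F`-linear function of the gradients and the keys. Which of them it may
involve is expressed by `Encodability` below. -/
structure LinearScheme (F : Type u) [Field F] (K N S L : ℕ) where
  /-- number of symbols of each key -/
  keyLen : ℕ
  /-- number of symbols sent by each server -/
  msgLen : Fin N → ℕ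
  /-- the encoding maps -/
  encode : ∀ n : Fin N,
    ((Fin K → Fin L → F) × (KeyGroup N S → Fin keyLen → F)) →ₗ[F] (Fin (msgLen n) → F)

/-- The gradients `g k` and the groupwise keys `Q V` are random vectors, all of them mutually
independent, and each key is uniformly distributed. The law of each gradient is arbitrary. -/
structure IsSource {F : Type u} [Field F] [Fintype F] [MeasurableSpace F] {K N S L ℓ : ℕ}
    {Ω : Type w} [MeasurableSpace Ω] (μ : Measure Ω)
    (g : Fin K → Ω → Fin L → F) (Q : KeyGroup N S → Ω → Fin ℓ → F) : Prop where
  measurable_gradient : ∀ k, Measurable (g k)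
  measurable_key : ∀ V, Measurable (Q V)
  indep_gradients : iIndepFun g μ
  indep_keys : iIndepFun Q μ
  indep_gradients_keys : IndepFun (fun ω k => g k ω) (fun ω V => Q V ω) μ
  uniform_key : ∀ V (a : Fin ℓ → F), μ.real (Q V ⁻¹' {a}) = 1 / (Fintype.card F : ℝ) ^ ℓ

namespace LinearScheme

section Constraints

variable {F : Type u} [Field F] {K N S L : ℕ}

/-- Communication cost: the largest normalized message length. -/
noncomputable def commCost (C : LinearScheme F K N S L) : ℝ :=
  ⨆ n : Fin N, (C.msgLen n : ℝ) / (L : ℝ)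

/-- The random message sent by server `n`. -/
def message (C : LinearScheme F K N S L) {Ω : Type w} (g : Fin K → Ω → Fin L → F)
    (Q : KeyGroup N S → Ω → Fin C.keyLen → F) (n : Fin N) (ω : Ω) : Fin (C.msgLen n) → F :=
  C.encode n (fun k => g k ω, fun V => Q V ω)

/-- `H(X_n | (g_k : n ∈ D_k), (Q_V : n ∈ V)) = 0` for every server `n`. -/
def Encodability [Fintype F] (C : LinearScheme F K N S L) (D : Fin K → Finset (Fin N))
    {Ω : Type w} [MeasurableSpace Ω] (μ : Measure Ω) (g : Fin K → Ω → Fin L → F)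
    (Q : KeyGroup N S → Ω → Fin C.keyLen → F) : Prop :=
  ∀ n : Fin N,
    condEntropy (Fintype.card F : ℝ) μ (C.message g Q n)
      (fun ω =>
        ((fun k : {k : Fin K // n ∈ D k} => g k.1 ω),
         (fun V : {V : KeyGroup N S // n ∈ V.1} => Q V.1 ω))) = 0

/-- `H(∑ g_k | (X_n : n ∈ U)) = 0` for every set `U` of `Nr` servers. -/
def Decodability [Fintype F] (C : LinearScheme F K N S L) (Nr : ℕ)
    {Ω : Type w} [MeasurableSpace Ω] (μ : Measure Ω) (g : Fin K → Ω → Fin L → F)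
    (Q : KeyGroup N S → Ω → Fin C.keyLen → F) : Prop :=
  ∀ U : Finset (Fin N), U.card = Nr →
    condEntropy (Fintype.card F : ℝ) μ (fun ω => ∑ k, g k ω)
      (fun ω => fun n : {n : Fin N // n ∈ U} => C.message g Q n.1 ω) = 0

/-- `I(X_1, …, X_N ; g_1, …, g_K | ∑ g_k) = 0`. -/
def Security [Fintype F] (C : LinearScheme F K N S L)
    {Ω : Type w} [MeasurableSpace Ω] (μ : Measure Ω) (g : Fin K → Ω → Fin L → F)
    (Q : KeyGroup N S → Ω → Fin C.keyLen → F) : Prop :=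
  condMutualInfo (Fintype.card F : ℝ) μ (fun ω n => C.message g Q n ω) (fun ω k => g k ω)
    (fun ω => ∑ k, g k ω) = 0

/-- The scheme solves the secure gradient coding problem with data assignment `D`
(dataset `k` is held by the servers in `D k`) and any `Nr` responding servers: all three
constraints hold, whatever the laws of the independent gradients. -/
def IsSecureGradientCode [Fintype F] [MeasurableSpace F] (C : LinearScheme F K N S L)
    (D : Fin K → Finset (Fin N)) (Nr : ℕ) : Prop :=
  ∀ (Ω : Type w) [MeasurableSpace Ω] (μ : Measure Ω) [IsProbabilityMeasure μ]
    (g : Fin K → Ω → Fin L → F) (Q : KeyGroup N S → Ω → Fin C.keyLen → F),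
    IsSource μ g Q →
      C.Encodability D μ g Q ∧ C.Decodability Nr μ g Q ∧ C.Security μ g Q

end Constraints

end LinearScheme

end SecureGradientCoding

/-!
Put `a = C(N,S) - C(M,S)`, `b = N - M` and `n = a * Nr - C(N,S) * b`. Let `E` be an extension of `F`
of degree `m`, and identify `F ^ L`, the keys and the messages with `E ^ n`, `E ^ b` and `E ^ a`, so
that the costs are in the ratio `a / n`. Server `i` sends `A i * y + B i * z`, where `y = ∑ k, g k`
and `z` stacks the padded keys `Q V + ∑ k, (Λ k (g k)) V` over all groups `V` of servers.

* Security holds since `z` is a one-time pad, uniform and independent of the gradients, while the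
  messages are equivalent to the pair `(y, z)`: `condMutualInfo_eq_zero_of_oneTimePad`.
* Decodability asks that the rows of `(A | B)` of any `Nr` servers, a square matrix because
  `n + C(N,S) * b = Nr * a`, are invertible.
* Encodability asks that `B i` vanishes on the keys of groups without `i`, and that
  `A i + B i * Λ k = 0` for the servers `i` that lack dataset `k`. These lie in a set `T` of `b`
  servers, exactly `a` groups meet `T`, and so the rows of `B` of the servers in `T` form a square
  matrix on the key symbols of those groups. If it is invertible, a suitable `Λ k` exists.

All these square matrices are invertible for a generic choice of the entries of `A` and of the
entries of `B` not forced to vanish, as soon as each zero pattern admits a perfect matching between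
rows and columns (`exists_matrix_forall_det_ne_zero`). By Birkhoff's theorem a fractional perfect
matching is enough, and one arises when every group splits its weight evenly among its members in
the given set of servers: by symmetry all of these servers receive the same (`sum_keyGroup_share`).
That `n` is positive is `choose_mul_sub_lt`.
-/

namespace SecureGradientCoding

open MeasureTheory ProbabilityTheory

/-! ### Entropy and the one-time pad -/

section EntropyLemmas

variable {Ω : Type w} [MeasurableSpace Ω]

/-- Entropy depends only on the partition of the sample space into the level sets of the random
variable. -/
theorem entropy_congr {α : Type u} {β : Type v} [Fintype α] [Fintype β] (b : ℝ) (μ : Measure Ω)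
    {X : Ω → α} {Y : Ω → β} (h : ∀ ω ω', X ω = X ω' ↔ Y ω = Y ω') :
    entropy b μ X = entropy b μ Y := by
  classical
  have key : ∀ ω, X ⁻¹' {X ω} = Y ⁻¹' {Y ω} := fun ω => by
    ext ω'; simp [h ω' ω]
  -- Values that are not taken contribute `0 * log 0 = 0`.
  have hX : ∀ x, -(μ.real (X ⁻¹' {x}) * Real.logb b (μ.real (X ⁻¹' {x}))) ≠ 0 →
      ∃ ω, X ω = x := by
    intro x hx
    by_contra! hcon
    have : X ⁻¹' {x} = ∅ := by ext ω; simp [hcon ω]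
    simp [this] at hx
  have hY : ∀ y, -(μ.real (Y ⁻¹' {y}) * Real.logb b (μ.real (Y ⁻¹' {y}))) ≠ 0 →
      ∃ ω, Y ω = y := by
    intro y hy
    by_contra! hcon
    have : Y ⁻¹' {y} = ∅ := by ext ω; simp [hcon ω]
    simp [this] at hy
  unfold entropy
  refine Finset.sum_bij_ne_zero (fun x _ hx => Y (hX x hx).choose) (by simp) ?_ ?_ ?_
  · intro x₁ _ h₁ x₂ _ h₂ heq
    rw [← h, (hX x₁ h₁).choose_spec, (hX x₂ h₂).choose_spec] at heq
    exact heq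
  · intro y _ hy
    obtain ⟨ω, rfl⟩ := hY y hy
    have hx : -(μ.real (X ⁻¹' {X ω}) * Real.logb b (μ.real (X ⁻¹' {X ω}))) ≠ 0 := by rwa [key]
    refine ⟨X ω, Finset.mem_univ _, hx, ?_⟩
    rw [← h]
    exact (hX (X ω) hx).choose_spec
  · intro x _ hx
    have hω := (hX x hx).choose_spec
    rw [← key, hω]

/-- A function of `Y` has no conditional entropy given `Y`. -/
theorem condEntropy_eq_zero {α : Type u} {β : Type v} [Fintype α] [Fintype β] (b : ℝ)
    (μ : Measure Ω) {X : Ω → α} {Y : Ω → β} (h : ∀ ω ω', Y ω = Y ω' → X ω = X ω') :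
    condEntropy b μ X Y = 0 := by
  rw [condEntropy, sub_eq_zero]
  refine entropy_congr b μ fun ω ω' => ?_
  rw [Prod.mk.injEq]
  exact ⟨fun e => e.2, fun e => ⟨h _ _ e, e⟩⟩

/-- The chain rule for a variable `T` that takes each of its values with probability `c`,
independently of `W`. -/
theorem entropy_prod_of_uniform {τ : Type u} {α : Type v} [Fintype τ] [Fintype α]
    [MeasurableSpace α] [MeasurableSingletonClass α] (b : ℝ) (μ : Measure Ω)
    [IsProbabilityMeasure μ] {T : Ω → τ} {W : Ω → α} (hW : Measurable W) {c : ℝ} (hc : c ≠ 0)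
    (hcard : Fintype.card τ * c = 1)
    (h : ∀ t x, μ.real ((fun ω => (T ω, W ω)) ⁻¹' {(t, x)}) = c * μ.real (W ⁻¹' {x})) :
    entropy b μ (fun ω => (T ω, W ω)) = entropy b μ W - Real.logb b c := by
  have hsum : ∑ x, μ.real (W ⁻¹' {x}) = 1 := by
    rw [sum_measureReal_preimage_singleton _ fun y _ => hW (measurableSet_singleton y)]
    simp
  have hterm : ∀ x, Fintype.card τ *
      -(c * μ.real (W ⁻¹' {x}) * Real.logb b (c * μ.real (W ⁻¹' {x}))) =
      -(μ.real (W ⁻¹' {x}) * Real.logb b (μ.real (W ⁻¹' {x}))) -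
        μ.real (W ⁻¹' {x}) * Real.logb b c := by
    intro x
    by_cases hx : μ.real (W ⁻¹' {x}) = 0
    · simp [hx]
    · rw [Real.logb_mul hc hx]
      linear_combination (-(μ.real (W ⁻¹' {x}) *
        (Real.logb b c + Real.logb b (μ.real (W ⁻¹' {x}))))) * hcard
  unfold entropy
  rw [Fintype.sum_prod_type]
  simp only [h]
  rw [Finset.sum_const, Finset.card_univ, nsmul_eq_mul, Finset.mul_sum]
  simp only [hterm]
  rw [Finset.sum_sub_distrib, ← Finset.sum_mul, hsum, one_mul]

/-- One-time pad: adding a uniform key `Q`, independent of `G`, to a function of `G` gives a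
uniform variable independent of every function of `G`. -/
theorem measureReal_oneTimePad {τ : Type u} {γ : Type v} {α : Type*} [Fintype γ]
    [MeasurableSpace τ] [MeasurableSpace γ] [MeasurableSingletonClass τ]
    [MeasurableSingletonClass γ] [AddGroup τ] (μ : Measure Ω) [IsFiniteMeasure μ]
    {Q : Ω → τ} {G : Ω → γ} (hQ : Measurable Q) (hG : Measurable G) (hind : IndepFun G Q μ) {c : ℝ}
    (hc : ∀ q, μ.real (Q ⁻¹' {q}) = c) (f : γ → τ) (h : γ → α) (t : τ) (x : α) :
    μ.real ((fun ω => (Q ω + f (G ω), h (G ω))) ⁻¹' {(t, x)}) =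
      c * μ.real ((fun ω => h (G ω)) ⁻¹' {x}) := by
  classical
  have hpt : ∀ y, (fun ω => (Q ω + f (G ω), G ω)) ⁻¹' {(t, y)} =
      G ⁻¹' {y} ∩ Q ⁻¹' {t - f y} := by
    intro y
    ext ω
    simp only [Set.mem_preimage, Set.mem_singleton_iff, Prod.mk.injEq, Set.mem_inter_iff]
    constructor
    · rintro ⟨h1, rfl⟩
      exact ⟨rfl, by rw [← h1, add_sub_cancel_right]⟩
    · rintro ⟨rfl, h1⟩
      exact ⟨by rw [h1, sub_add_cancel], rfl⟩
  have hmeas : ∀ y, MeasurableSet (G ⁻¹' {y} ∩ Q ⁻¹' {t - f y}) := fun y =>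
    (hG (measurableSet_singleton y)).inter (hQ (measurableSet_singleton _))
  have hprob : ∀ y, μ.real (G ⁻¹' {y} ∩ Q ⁻¹' {t - f y}) = c * μ.real (G ⁻¹' {y}) := by
    intro y
    rw [measureReal_def, hind.measure_inter_preimage_eq_mul _ _ (measurableSet_singleton _)
      (measurableSet_singleton _), ENNReal.toReal_mul, ← measureReal_def, ← measureReal_def, hc,
      mul_comm]
  let s : Finset γ := Finset.univ.filter fun y => h y = x
  have h1 : (fun ω => (Q ω + f (G ω), h (G ω))) ⁻¹' {(t, x)} =
      (fun ω => (Q ω + f (G ω), G ω)) ⁻¹' ↑(s.map ⟨fun y => (t, y), Prod.mk_right_injective t⟩) := by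
    ext ω
    simp [s, and_comm, eq_comm]
  have h2 : (fun ω => h (G ω)) ⁻¹' {x} = G ⁻¹' ↑s := by
    ext ω
    simp [s]
  rw [h1, h2, ← sum_measureReal_preimage_singleton, ← sum_measureReal_preimage_singleton,
    Finset.sum_map, Finset.mul_sum]
  · exact Finset.sum_congr rfl fun y _ => by
      rw [← hprob, ← hpt]; rfl
  · exact fun y _ => hG (measurableSet_singleton y)
  · intro p hp
    obtain ⟨y, _, rfl⟩ := Finset.mem_map.1 hp
    have := hmeas y
    rw [← hpt] at this
    exact this

/-- If `X` and `h(G)` together carry the same information as `Q + f(G)` and `h(G)`, where `Q` is a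
uniform key independent of `G`, then `X` reveals nothing about `G` beyond `h(G)`. -/
theorem condMutualInfo_eq_zero_of_oneTimePad {τ : Type*} {ξ γ α : Type u} [Fintype τ] [Fintype ξ]
    [Fintype γ] [Fintype α] [MeasurableSpace τ] [MeasurableSpace γ] [MeasurableSpace α]
    [MeasurableSingletonClass τ]
    [MeasurableSingletonClass γ] [MeasurableSingletonClass α] [AddGroup τ] (b : ℝ) (μ : Measure Ω)
    [IsProbabilityMeasure μ] {Q : Ω → τ} {G : Ω → γ} (hQ : Measurable Q) (hG : Measurable G)
    (hind : IndepFun G Q μ) {c : ℝ} (hc : ∀ q, μ.real (Q ⁻¹' {q}) = c) (f : γ → τ) (h : γ → α)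
    (X : Ω → ξ)
    (hX : ∀ ω ω', h (G ω) = h (G ω') →
      (X ω = X ω' ↔ Q ω + f (G ω) = Q ω' + f (G ω'))) :
    condMutualInfo b μ X G (fun ω => h (G ω)) = 0 := by
  have hcard : Fintype.card τ * c = 1 := by
    have := sum_measureReal_preimage_singleton (μ := μ) (f := Q) Finset.univ
      fun y _ => hQ (measurableSet_singleton y)
    simpa [hc] using this
  have hc0 : c ≠ 0 := right_ne_zero_of_mul_eq_one hcard
  have hhG : Measurable fun ω => h (G ω) := (measurable_of_finite h).comp hG
  have e1 : entropy b μ (fun ω => (X ω, h (G ω))) =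
      entropy b μ (fun ω => (Q ω + f (G ω), h (G ω))) := by
    refine entropy_congr b μ fun ω ω' => ?_
    rw [Prod.mk.injEq, Prod.mk.injEq]
    exact and_congr_left fun e => hX _ _ e
  have e2 : entropy b μ (fun ω => (X ω, (G ω, h (G ω)))) =
      entropy b μ (fun ω => (Q ω + f (G ω), G ω)) := by
    refine entropy_congr b μ fun ω ω' => ?_
    simp only [Prod.mk.injEq]
    constructor
    · rintro ⟨e, e', e''⟩
      exact ⟨(hX _ _ e'').1 e, e'⟩
    · rintro ⟨e, e'⟩
      have e'' : h (G ω) = h (G ω') := by rw [e']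
      exact ⟨(hX _ _ e'').2 e, e', e''⟩
  have e3 : entropy b μ (fun ω => (G ω, h (G ω))) = entropy b μ G := by
    refine entropy_congr b μ fun ω ω' => ?_
    rw [Prod.mk.injEq]
    exact ⟨fun e => e.1, fun e => ⟨e, by rw [e]⟩⟩
  rw [condMutualInfo, condEntropy, condEntropy, e1, e2, e3,
    entropy_prod_of_uniform b μ hhG hc0 hcard
      (measureReal_oneTimePad μ hQ hG hind hc f h),
    entropy_prod_of_uniform b μ hG hc0 hcard
      (measureReal_oneTimePad μ hQ hG hind hc f id)]
  ring

end EntropyLemmas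

/-! ### Matchings between servers and key groups -/

/-- A fractional perfect matching of a bipartite graph contains a perfect matching (Birkhoff). -/
theorem exists_equiv_of_fractional_matching {R C : Type*} [Fintype R] [Fintype C]
    (x : R → C → ℝ) (hx : ∀ r c, 0 ≤ x r c) (hrow : ∀ r, ∑ c, x r c = 1)
    (hcol : ∀ c, ∑ r, x r c = 1) : ∃ e : R ≃ C, ∀ r, x r (e r) ≠ 0 := by
  classical
  have hcard : Fintype.card R = Fintype.card C := by
    have h1 : ∑ r, ∑ c, x r c = Fintype.card R := by simp [hrow]
    have h2 : ∑ r, ∑ c, x r c = Fintype.card C := by rw [Finset.sum_comm]; simp [hcol]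
    exact_mod_cast h1.symm.trans h2
  obtain ⟨e₀⟩ := Fintype.card_eq.1 hcard
  let A : Matrix R R ℝ := fun r s => x r (e₀ s)
  have hA : A ∈ doublyStochastic ℝ R := by
    rw [mem_doublyStochastic_iff_sum]
    refine ⟨fun r s => hx _ _, fun r => ?_, fun s => hcol _⟩
    rw [← hrow r]
    exact e₀.sum_comp (x r)
  obtain ⟨wt, hwt, hsum, hA'⟩ := exists_eq_sum_perm_of_mem_doublyStochastic hA
  obtain ⟨σ, -, hσ⟩ : ∃ σ ∈ Finset.univ, wt σ ≠ 0 :=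
    Finset.exists_ne_zero_of_sum_ne_zero (by rw [hsum]; exact one_ne_zero)
  refine ⟨σ.trans e₀, fun r => ?_⟩
  have hr : x r (e₀ (σ r)) = ∑ τ, wt τ * τ.permMatrix ℝ r (σ r) := by
    change A r (σ r) = _
    rw [← hA', Matrix.sum_apply]
    rfl
  have hnn : ∀ τ ∈ Finset.univ, 0 ≤ wt τ * Equiv.Perm.permMatrix ℝ τ r (σ r) := by
    intro τ _
    refine mul_nonneg (hwt τ) ?_
    rw [Equiv.Perm.permMatrix, PEquiv.toMatrix_apply]
    split_ifs <;> norm_num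
  have hpos : 0 < wt σ := lt_of_le_of_ne (hwt σ) hσ.symm
  have hle := Finset.single_le_sum hnn (Finset.mem_univ σ)
  rw [← hr] at hle
  refine (lt_of_lt_of_le ?_ hle).ne'
  simpa [Equiv.Perm.permMatrix, PEquiv.toMatrix_apply] using hpos

/-- Relabelling the servers by a permutation relabels the groups. -/
def permKeyGroup {N : ℕ} (S : ℕ) (σ : Equiv.Perm (Fin N)) : KeyGroup N S ≃ KeyGroup N S where
  toFun V := ⟨V.1.map σ.toEmbedding, by rw [Finset.card_map, V.2]⟩
  invFun V := ⟨V.1.map σ.symm.toEmbedding, by rw [Finset.card_map, V.2]⟩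
  left_inv V := by ext; simp
  right_inv V := by ext; simp

/-- If every group that meets `U` spreads one unit evenly over its members in `U`, then all
members of `U` receive the same amount. -/
theorem sum_keyGroup_share {N : ℕ} (S : ℕ) (U : Finset (Fin N)) {i : Fin N} (hi : i ∈ U) :
    ∑ V : KeyGroup N S, (if i ∈ V.1 then ((V.1 ∩ U).card : ℝ)⁻¹ else 0) =
      (Finset.univ.filter fun V : KeyGroup N S => (V.1 ∩ U).Nonempty).card / (U.card : ℝ) := by
  classical
  set f : Fin N → ℝ :=
    fun j => ∑ V : KeyGroup N S, (if j ∈ V.1 then ((V.1 ∩ U).card : ℝ)⁻¹ else 0) with hf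
  have hsymm : ∀ j ∈ U, f j = f i := by
    intro j hj
    refine Fintype.sum_equiv (permKeyGroup S (Equiv.swap i j)) _ _ fun V => ?_
    have hU : U.map (Equiv.swap i j).toEmbedding = U := by
      refine Finset.eq_of_subset_of_card_le (fun x hx => ?_) (by rw [Finset.card_map])
      obtain ⟨y, hy, rfl⟩ := Finset.mem_map.1 hx
      rw [Equiv.coe_toEmbedding, Equiv.swap_apply_def]
      split_ifs <;> assumption
    have hcard : (V.1.map (Equiv.swap i j).toEmbedding ∩ U).card = (V.1 ∩ U).card := by
      conv_lhs => rw [← hU]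
      rw [← Finset.map_inter, Finset.card_map]
    have hmem : i ∈ V.1.map (Equiv.swap i j).toEmbedding ↔ j ∈ V.1 := by
      rw [Finset.mem_map_equiv, Equiv.symm_swap, Equiv.swap_apply_left]
    simp only [permKeyGroup, Equiv.coe_fn_mk, hcard, hmem]
  have htotal : ∑ j ∈ U, f j =
      (Finset.univ.filter fun V : KeyGroup N S => (V.1 ∩ U).Nonempty).card := by
    rw [hf, Finset.sum_comm, Finset.card_filter, Nat.cast_sum]
    refine Finset.sum_congr rfl fun V _ => ?_
    rw [← Finset.sum_filter, Finset.sum_const, nsmul_eq_mul, Finset.filter_mem_eq_inter,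
      Finset.inter_comm]
    by_cases h : (V.1 ∩ U).Nonempty
    · rw [if_pos h, mul_inv_cancel₀ (by exact_mod_cast h.card_pos.ne')]
      simp
    · rw [if_neg h]
      simp [Finset.not_nonempty_iff_eq_empty.1 h]
  rw [Finset.sum_congr rfl hsymm, Finset.sum_const, nsmul_eq_mul] at htotal
  have hU : (U.card : ℝ) ≠ 0 := by exact_mod_cast (Finset.card_pos.2 ⟨i, hi⟩).ne'
  rw [eq_div_iff hU, mul_comm]
  exact htotal

theorem card_keyGroup_meets_add {N : ℕ} (S : ℕ) (U : Finset (Fin N)) :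
    (Finset.univ.filter fun V : KeyGroup N S => (V.1 ∩ U).Nonempty).card +
      (N - U.card).choose S = N.choose S := by
  classical
  have h1 : (Finset.univ.filter fun V : KeyGroup N S => ¬ (V.1 ∩ U).Nonempty).card =
      (N - U.card).choose S := by
    have hc : (Uᶜ : Finset (Fin N)).card = N - U.card := by
      rw [Finset.card_compl, Fintype.card_fin]
    rw [← hc, ← Finset.card_powersetCard]
    refine Finset.card_bij (fun V _ => V.1) ?_ ?_ ?_
    · intro V hV
      rw [Finset.mem_filter, Finset.not_nonempty_iff_eq_empty,
        ← Finset.disjoint_iff_inter_eq_empty] at hV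
      rw [Finset.mem_powersetCard, Finset.subset_compl_iff_disjoint_right]
      exact ⟨hV.2, V.2⟩
    · exact fun V _ V' _ h => Subtype.ext h
    · intro W hW
      rw [Finset.mem_powersetCard, Finset.subset_compl_iff_disjoint_right] at hW
      refine ⟨⟨W, hW.2⟩, ?_, rfl⟩
      rw [Finset.mem_filter, Finset.not_nonempty_iff_eq_empty,
        ← Finset.disjoint_iff_inter_eq_empty]
      exact ⟨Finset.mem_univ _, hW.1⟩
  rw [← h1, Finset.card_filter_add_card_filter_not, Finset.card_univ,
    Fintype.card_finset_len, Fintype.card_fin]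

/-! ### Generic matrices with a zero pattern -/

theorem totalDegree_det_le {ι σ E : Type*} [Fintype ι] [DecidableEq ι] [CommRing E]
    (A : Matrix ι ι (MvPolynomial σ E)) (hA : ∀ r s, (A r s).totalDegree ≤ 1) :
    A.det.totalDegree ≤ Fintype.card ι := by
  rw [Matrix.det_apply]
  refine MvPolynomial.totalDegree_finsetSum_le fun τ _ => ?_
  refine (MvPolynomial.totalDegree_smul_le _ _).trans ?_
  refine (MvPolynomial.totalDegree_finsetProd _ _).trans ?_
  refine (Finset.sum_le_card_nsmul _ _ 1 fun r _ => hA _ _).trans ?_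
  simp

/-- Over a large finite field there is a matrix with prescribed zero pattern such that all the
given square submatrices, each with an allowed nonzero diagonal, are invertible at once. The rows
and columns of the submatrix with index `j` are listed by `ρ j` and `κ j`. -/
theorem exists_matrix_forall_det_ne_zero {R C J : Type*} [Finite R] [Finite C] [Fintype J]
    {ι : J → Type*} [∀ j, Fintype (ι j)] [∀ j, DecidableEq (ι j)] (allowed : R → C → Prop)
    (ρ : ∀ j, ι j → R) (κ : ∀ j, ι j → C) (hρ : ∀ j, (ρ j).Injective)
    (hκ : ∀ j, (κ j).Injective) (hρκ : ∀ j r, allowed (ρ j r) (κ j r))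
    (E : Type*) [Field E] [Finite E] (hcard : ∑ j, Fintype.card (ι j) < Nat.card E) :
    ∃ G : Matrix R C E, (∀ r c, ¬ allowed r c → G r c = 0) ∧
      ∀ j, (G.submatrix (ρ j) (κ j)).det ≠ 0 := by
  classical
  have := Fintype.ofFinite E
  let G (g : R × C → E) : Matrix R C E :=
    .of fun r c => if allowed r c then g (r, c) else 0
  let GX : Matrix R C (MvPolynomial (R × C) E) :=
    .of fun r c => if allowed r c then MvPolynomial.X (r, c) else 0
  let P (j : J) : MvPolynomial (R × C) E := (GX.submatrix (ρ j) (κ j)).det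
  have heval : ∀ g j, MvPolynomial.eval g (P j) = ((G g).submatrix (ρ j) (κ j)).det := by
    intro g j
    rw [RingHom.map_det]
    congr 1
    ext r s
    simp only [GX, G, RingHom.mapMatrix_apply, Matrix.map_apply, Matrix.submatrix_apply,
      Matrix.of_apply]
    split_ifs <;> simp
  have hdeg : ∀ j, (P j).totalDegree ≤ Fintype.card (ι j) := by
    intro j
    refine totalDegree_det_le _ fun r s => ?_
    simp only [GX, Matrix.submatrix_apply, Matrix.of_apply]
    split_ifs <;> simp
  have hP : ∀ j, P j ≠ 0 := by
    intro j h0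
    -- The indicator of the diagonal turns the submatrix into the identity matrix.
    let g : R × C → E := fun p => if ∃ r, ρ j r = p.1 ∧ κ j r = p.2 then 1 else 0
    have h1 : (G g).submatrix (ρ j) (κ j) = 1 := by
      ext r s
      have hrs : (∃ t, ρ j t = ρ j r ∧ κ j t = κ j s) ↔ r = s :=
        ⟨fun ⟨t, h, h'⟩ => (hρ j h).symm.trans (hκ j h'), fun h => ⟨r, rfl, by rw [h]⟩⟩
      simp only [G, g, Matrix.submatrix_apply, Matrix.of_apply, hrs, Matrix.one_apply]
      by_cases h : r = s
      · subst h
        simp [hρκ]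
      · simp [h]
    have := heval g j
    rw [h0, h1, map_zero, Matrix.det_one] at this
    exact zero_ne_one this
  have hprod : ∏ j, P j ≠ 0 := Finset.prod_ne_zero_iff.2 fun j _ => hP j
  have hproddeg : (∏ j, P j).totalDegree < Nat.card E :=
    lt_of_le_of_lt ((MvPolynomial.totalDegree_finsetProd _ _).trans
      (Finset.sum_le_sum fun j _ => hdeg j)) hcard
  obtain ⟨g, hg⟩ : ∃ g, MvPolynomial.eval g (∏ j, P j) ≠ 0 := by
    by_contra! hcon
    refine hprod (MvPolynomial.eq_zero_of_eval_zero_at_prod_finset _ (fun _ => Finset.univ)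
      (fun p => ?_) fun g _ => hcon g)
    rw [Finset.card_univ, ← Nat.card_eq_fintype_card]
    exact (MvPolynomial.degreeOf_le_totalDegree _ _).trans_lt hproddeg
  refine ⟨G g, fun r c h => if_neg h, fun j => ?_⟩
  rw [← heval]
  rw [map_prod] at hg
  exact Finset.prod_ne_zero_iff.1 hg j (Finset.mem_univ j)

/-! ### The coding matrices -/

/-- Every key symbol of a group that meets `U` spreads a total weight of one over the rows of the
servers in `U`. -/
theorem sum_rows_share {N S : ℕ} {a : ℕ} (ha : 0 < a) (U : Finset (Fin N)) (V : KeyGroup N S)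
    (hV : (V.1 ∩ U).Nonempty) :
    ∑ r : {i // i ∈ U} × Fin a, (if r.1.1 ∈ V.1 then ((V.1 ∩ U).card : ℝ)⁻¹ else 0) / a = 1 := by
  have ha' : (a : ℝ) ≠ 0 := by exact_mod_cast ha.ne'
  have hV' : ((V.1 ∩ U).card : ℝ) ≠ 0 := by exact_mod_cast hV.card_pos.ne'
  refine (Fintype.sum_prod_type' fun (i : {i // i ∈ U}) (_ : Fin a) =>
    (if i.1 ∈ V.1 then ((V.1 ∩ U).card : ℝ)⁻¹ else 0) / a).trans ?_
  simp only [Finset.sum_const, Finset.card_univ, Fintype.card_fin, nsmul_eq_mul,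
    mul_div_cancel₀ _ ha']
  rw [Finset.univ_eq_attach,
    Finset.sum_attach U fun i => if i ∈ V.1 then ((V.1 ∩ U).card : ℝ)⁻¹ else 0,
    ← Finset.sum_filter, Finset.filter_mem_eq_inter, Finset.inter_comm, Finset.sum_const,
    nsmul_eq_mul, mul_inv_cancel₀ hV']

/-- The rows of the servers in a set `T` of `b` servers can be matched to the key symbols of the
groups that meet `T`. -/
theorem exists_matching_groups_meeting {N S a b : ℕ} (ha : 0 < a)
    (hab : a + (N - b).choose S = N.choose S) (T : Finset (Fin N)) (hT : T.card = b) :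
    ∃ e : ({i // i ∈ T} × Fin a) ≃ ({V : KeyGroup N S // (V.1 ∩ T).Nonempty} × Fin b),
      ∀ r, r.1.1 ∈ (e r).1.1.1 := by
  have ha' : (a : ℝ) ≠ 0 := by exact_mod_cast ha.ne'
  have hcard := card_keyGroup_meets_add S T
  rw [hT, ← hab, Nat.add_right_cancel_iff] at hcard
  let x (r : {i // i ∈ T} × Fin a) (c : {V : KeyGroup N S // (V.1 ∩ T).Nonempty} × Fin b) : ℝ :=
    (if r.1.1 ∈ c.1.1.1 then ((c.1.1.1 ∩ T).card : ℝ)⁻¹ else 0) / a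
  have hrow : ∀ r, ∑ c, x r c = 1 := by
    intro r
    have hb : (b : ℝ) ≠ 0 := by
      rw [← hT]; exact_mod_cast (Finset.card_pos.2 ⟨_, r.1.2⟩).ne'
    refine (Fintype.sum_prod_type' fun (V : {V : KeyGroup N S // (V.1 ∩ T).Nonempty})
      (_ : Fin b) => (if r.1.1 ∈ V.1.1 then ((V.1.1 ∩ T).card : ℝ)⁻¹ else 0) / a).trans ?_
    simp only [Finset.sum_const, Finset.card_univ, Fintype.card_fin, nsmul_eq_mul]
    rw [← Finset.mul_sum, ← Finset.sum_div]
    have h1 : ∑ c : {V : KeyGroup N S // (V.1 ∩ T).Nonempty},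
        (if r.1.1 ∈ c.1.1 then ((c.1.1 ∩ T).card : ℝ)⁻¹ else 0) =
        ∑ V : KeyGroup N S, (if r.1.1 ∈ V.1 then ((V.1 ∩ T).card : ℝ)⁻¹ else 0) := by
      refine Fintype.sum_of_injective (fun c => c.1) Subtype.val_injective _ _ ?_ fun c => rfl
      intro V hV
      refine if_neg fun hi => hV ⟨⟨V, ⟨r.1.1, Finset.mem_inter.2 ⟨hi, r.1.2⟩⟩⟩, rfl⟩
    rw [h1, sum_keyGroup_share S T r.1.2, hcard, hT]
    field_simp
  obtain ⟨e, he⟩ := exists_equiv_of_fractional_matching x (fun r c => by positivity) hrow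
    fun c => sum_rows_share ha T c.1.1 c.1.2
  refine ⟨e, fun r => ?_⟩
  by_contra hcon
  exact he r (by simp [x, hcon])

/-- The rows of `Nr` servers can be matched to the gradient symbols and all key symbols. -/
theorem exists_matching_all {N S Nr a b n : ℕ} (ha : 0 < a)
    (hn : n + N.choose S * b = Nr * a) (hS : N < S + Nr) (U : Finset (Fin N))
    (hU : U.card = Nr) :
    ∃ e : ({i // i ∈ U} × Fin a) ≃ (Fin n ⊕ KeyGroup N S × Fin b),
      ∀ r p, e r = Sum.inr p → r.1.1 ∈ p.1.1 := by
  have ha' : (a : ℝ) ≠ 0 := by exact_mod_cast ha.ne'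
  have hmeets : ∀ V : KeyGroup N S, (V.1 ∩ U).Nonempty := by
    intro V
    by_contra hcon
    rw [Finset.not_nonempty_iff_eq_empty, ← Finset.disjoint_iff_inter_eq_empty] at hcon
    have h1 := Finset.card_le_univ (V.1 ∪ U)
    rw [Finset.card_union_of_disjoint hcon, V.2, hU, Fintype.card_fin] at h1
    omega
  have hrows : Fintype.card ({i // i ∈ U} × Fin a) = Nr * a := by simp [hU]
  -- A gradient column exists only if `0 < n`, which forces `Nr * a` to be positive.
  have hNr : Fin n → (Nr : ℝ) * a ≠ 0 := by
    intro c
    have : 0 < Nr * a := by rw [← hn]; have := c.pos; omega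
    exact_mod_cast this.ne'
  -- A key symbol is spread evenly over the rows of the members of its group in `U`, a gradient
  -- symbol evenly over all rows.
  let x (r : {i // i ∈ U} × Fin a) : Fin n ⊕ KeyGroup N S × Fin b → ℝ :=
    Sum.elim (fun _ => ((Nr : ℝ) * a)⁻¹)
      (fun p => (if r.1.1 ∈ p.1.1 then ((p.1.1 ∩ U).card : ℝ)⁻¹ else 0) / a)
  have hx : ∀ r c, 0 ≤ x r c := by
    rintro r (c | p) <;> simp only [x, Sum.elim_inl, Sum.elim_inr] <;> positivity
  have hrow : ∀ r, ∑ c, x r c = 1 := by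
    intro r
    have hNr0 : (Nr : ℝ) ≠ 0 := by
      rw [← hU]; exact_mod_cast (Finset.card_pos.2 ⟨_, r.1.2⟩).ne'
    have hcard : (Finset.univ.filter fun V : KeyGroup N S => (V.1 ∩ U).Nonempty).card =
        N.choose S := by
      rw [Finset.filter_true_of_mem fun V _ => hmeets V, Finset.card_univ,
        Fintype.card_finset_len, Fintype.card_fin]
    have hn' : (n : ℝ) + N.choose S * b = Nr * a := by exact_mod_cast hn
    have h1 : ∑ p : KeyGroup N S × Fin b, x r (Sum.inr p) =
        ∑ V : KeyGroup N S, ∑ _β : Fin b,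
          (if r.1.1 ∈ V.1 then ((V.1 ∩ U).card : ℝ)⁻¹ else 0) / a :=
      Fintype.sum_prod_type' fun (V : KeyGroup N S) (_ : Fin b) =>
        (if r.1.1 ∈ V.1 then ((V.1 ∩ U).card : ℝ)⁻¹ else 0) / a
    rw [Fintype.sum_sum_type, h1]
    simp only [x, Sum.elim_inl, Finset.sum_const, Finset.card_univ, Fintype.card_fin,
      nsmul_eq_mul]
    rw [← Finset.mul_sum, ← Finset.sum_div, sum_keyGroup_share S U r.1.2, hcard, hU]
    field_simp
    linarith
  have hcol : ∀ c, ∑ r, x r c = 1 := by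
    rintro (c | p)
    · simp only [x, Sum.elim_inl, Finset.sum_const, Finset.card_univ, nsmul_eq_mul, hrows]
      push_cast
      exact mul_inv_cancel₀ (hNr c)
    · exact sum_rows_share ha U p.1 (hmeets p.1)
  obtain ⟨e, he⟩ := exists_equiv_of_fractional_matching x hx hrow hcol
  refine ⟨e, fun r p hp => ?_⟩
  by_contra hcon
  exact he r (by simp [x, hp, hcon])

/-- The coding matrices. Row `(i, α)` is symbol `α` of the message of server `i`; `A` acts on the
sum of the gradients and `B` on the padded keys. The three clauses say that a server uses only its
own keys, that any `Nr` servers determine everything, and that the contribution of a gradient to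
the messages of any `b` servers can be cancelled through the keys. The bound on the field depends
only on the combinatorial parameters. -/
theorem exists_coding_matrices {N S Nr a b n : ℕ} (ha : 0 < a)
    (hab : a + (N - b).choose S = N.choose S) (hn : n + N.choose S * b = Nr * a)
    (hS : N < S + Nr) (E : Type*) [Field E] [Finite E]
    (hE : 2 ^ N * (Nr * a) + 2 ^ N * (b * a) < Nat.card E) :
    ∃ (A : Matrix (Fin N × Fin a) (Fin n) E)
      (B : Matrix (Fin N × Fin a) (KeyGroup N S × Fin b) E),
      (∀ i α p, i ∉ p.1.1 → B (i, α) p = 0) ∧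
      (∀ U : Finset (Fin N), U.card = Nr → ∀ y z,
        (∀ i ∈ U, ∀ α, (A.mulVec y + B.mulVec z) (i, α) = 0) → y = 0 ∧ z = 0) ∧
      ∀ T : Finset (Fin N), T.card = b → ∃ Λ : Matrix (KeyGroup N S × Fin b) (Fin n) E,
        ∀ i ∈ T, ∀ α, (A + B * Λ) (i, α) = 0 := by
  classical
  choose e₁ he₁ using fun U : {U : Finset (Fin N) // U.card = Nr} =>
    exists_matching_all ha hn hS U.1 U.2
  choose e₂ he₂ using fun T : {T : Finset (Fin N) // T.card = b} =>
    exists_matching_groups_meeting ha hab T.1 T.2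
  -- One square submatrix for each set of `Nr` servers and one for each set of `b` servers; the
  -- columns are listed along the matching, which puts the allowed entries on the diagonal.
  let J := {U : Finset (Fin N) // U.card = Nr} ⊕ {T : Finset (Fin N) // T.card = b}
  let rows : J → Finset (Fin N) := Sum.elim Subtype.val Subtype.val
  let ι : J → Type := fun j => {i // i ∈ rows j} × Fin a
  let ρ : ∀ j, ι j → Fin N × Fin a := fun j r => (r.1.1, r.2)
  let κ : ∀ j, ι j → Fin n ⊕ KeyGroup N S × Fin b := fun j => match j with
    | .inl U => fun r => e₁ U r
    | .inr T => fun r => .inr ((e₂ T r).1.1, (e₂ T r).2)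
  have hρ : ∀ j, (ρ j).Injective := by
    intro j r s h
    have h' : (r.1.1, r.2) = (s.1.1, s.2) := h
    rw [Prod.mk.injEq] at h'
    exact Prod.ext (Subtype.ext h'.1) h'.2
  have hκ : ∀ j, (κ j).Injective := by
    rintro (U | T) r s h
    · exact (e₁ U).injective h
    · have h' := Sum.inr_injective h
      rw [Prod.mk.injEq] at h'
      exact (e₂ T).injective (Prod.ext (Subtype.ext h'.1) h'.2)
  have hρκ : ∀ j r p, κ j r = Sum.inr p → (ρ j r).1 ∈ p.1.1 := by
    rintro (U | T) r p hp
    · exact he₁ U r p hp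
    · rw [← Sum.inr_injective hp]
      exact he₂ T r
  have hcard : ∑ j, Fintype.card (ι j) < Nat.card E := by
    refine lt_of_le_of_lt ?_ hE
    have hsub : ∀ k, Fintype.card {U : Finset (Fin N) // U.card = k} ≤ 2 ^ N := fun k => by
      rw [Fintype.card_finset_len, Fintype.card_fin]; exact Nat.choose_le_two_pow N k
    have hι : ∀ j, Fintype.card (ι j) = (rows j).card * a := fun j => by
      change Fintype.card ({i // i ∈ rows j} × Fin a) = _
      rw [Fintype.card_prod, Fintype.card_coe, Fintype.card_fin]
    simp only [hι]
    rw [Fintype.sum_sum_type]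
    refine Nat.add_le_add ?_ ?_
    · refine (Finset.sum_le_card_nsmul _ _ (Nr * a) fun U _ => ?_).trans ?_
      · exact (congrArg (· * a) U.2).le
      · rw [smul_eq_mul]; exact Nat.mul_le_mul_right _ (hsub Nr)
    · refine (Finset.sum_le_card_nsmul _ _ (b * a) fun U _ => ?_).trans ?_
      · exact (congrArg (· * a) U.2).le
      · rw [smul_eq_mul]; exact Nat.mul_le_mul_right _ (hsub b)
  obtain ⟨G, hG0, hG⟩ := exists_matrix_forall_det_ne_zero (J := J) (ι := ι)
    (fun (r : Fin N × Fin a) (c : Fin n ⊕ KeyGroup N S × Fin b) =>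
      ∀ p, c = Sum.inr p → r.1 ∈ p.1.1) ρ κ hρ hκ hρκ E hcard
  refine ⟨G.submatrix id Sum.inl, G.submatrix id Sum.inr, ?_, ?_, ?_⟩
  · intro i α p hi
    exact hG0 _ _ fun h => hi (h p rfl)
  · intro U hU y z h
    have hdet := hG (.inl ⟨U, hU⟩)
    have hv := Matrix.eq_zero_of_mulVec_eq_zero hdet
      (v := fun r => Sum.elim y z (e₁ ⟨U, hU⟩ r)) (by
        ext r
        have hr := h r.1.1 r.1.2 r.2
        rw [Matrix.mulVec, dotProduct, Pi.zero_apply, ← hr]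
        refine ((e₁ ⟨U, hU⟩).sum_comp fun c => G (ρ (.inl ⟨U, hU⟩) r) c * Sum.elim y z c).trans ?_
        rw [Fintype.sum_sum_type]
        rfl)
    have hv' : ∀ c, Sum.elim y z c = 0 := fun c => by
      have h0 : Sum.elim y z (e₁ ⟨U, hU⟩ ((e₁ ⟨U, hU⟩).symm c)) = 0 := congrFun hv _
      rwa [Equiv.apply_symm_apply] at h0
    exact ⟨funext fun c => hv' (.inl c), funext fun p => hv' (.inr p)⟩
  · intro T hT
    have hdet := hG (.inr ⟨T, hT⟩)
    -- The witness solves `H * Λ = -A` on the groups that meet `T` and is zero elsewhere. Groups that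
    -- do not meet `T` do not matter, as `B` vanishes there on the rows of `T`.
    set e := e₂ ⟨T, hT⟩
    set H := G.submatrix (ρ (.inr ⟨T, hT⟩)) (κ (.inr ⟨T, hT⟩))
    let W : Matrix (ι (.inr ⟨T, hT⟩)) (Fin n) E := H⁻¹ * G.submatrix (ρ (.inr ⟨T, hT⟩)) Sum.inl
    have hW : H * W = G.submatrix (ρ (.inr ⟨T, hT⟩)) Sum.inl :=
      Matrix.mul_nonsing_inv_cancel_left _ _ (isUnit_iff_ne_zero.2 hdet)
    refine ⟨.of fun p c => if h : (p.1.1 ∩ T).Nonempty then -W (e.symm (⟨p.1, h⟩, p.2)) c else 0,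
      fun i hi α => ?_⟩
    ext c
    let r : ι (.inr ⟨T, hT⟩) := (⟨i, hi⟩, α)
    have hr : G (i, α) (Sum.inl c) = ∑ s, H r s * W s c := by
      rw [← Matrix.mul_apply, hW]; rfl
    rw [Matrix.add_apply, Matrix.mul_apply, Pi.zero_apply, Matrix.submatrix_apply, id, hr,
      ← eq_neg_iff_add_eq_zero, ← Finset.sum_neg_distrib]
    refine Fintype.sum_of_injective (fun s => ((e s).1.1, (e s).2)) ?_ _ _ ?_ ?_
    · intro s t hst
      rw [Prod.mk.injEq] at hst
      exact e.injective (Prod.ext (Subtype.ext hst.1) hst.2)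
    · intro p hp
      by_cases h : (p.1.1 ∩ T).Nonempty
      · exact absurd ⟨e.symm (⟨p.1, h⟩, p.2), by simp⟩ hp
      · simp [h]
    · intro s
      rw [Matrix.of_apply, dif_pos (e s).1.2, mul_neg, neg_neg]
      change _ = _ * W (e.symm (e s)) c
      rw [Equiv.symm_apply_apply]
      rfl

/-! ### From coding matrices to a secure code -/

/-- A deterministic criterion for a secure gradient code. The messages of any `Nr` servers, and
hence those of all servers, amount to the sum of the gradients together with the keys padded by a
function `f` of the gradients, and server `i` uses only what it holds. -/
theorem LinearScheme.isSecureGradientCode_of {F : Type u} [Field F] [Fintype F]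
    [MeasurableSpace F] [DiscreteMeasurableSpace F] {K N S L Nr : ℕ} (hNr : Nr ≤ N)
    (C : LinearScheme F K N S L) (D : Fin K → Finset (Fin N))
    (f : (Fin K → Fin L → F) → KeyGroup N S → Fin C.keyLen → F)
    (henc : ∀ i p, (∀ k, i ∈ D k → p.1 k = 0) → (∀ V : KeyGroup N S, i ∈ V.1 → p.2 V = 0) →
      C.encode i p = 0)
    (hdec : ∀ U : Finset (Fin N), U.card = Nr → ∀ p p',
      (∀ i ∈ U, C.encode i p = C.encode i p') →
        ∑ k, p.1 k = ∑ k, p'.1 k ∧ p.2 + f p.1 = p'.2 + f p'.1)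
    (hmsg : ∀ p p', ∑ k, p.1 k = ∑ k, p'.1 k → p.2 + f p.1 = p'.2 + f p'.1 →
      ∀ i, C.encode i p = C.encode i p') :
    IsSecureGradientCode.{u, w} C D Nr := by
  intro Ω _ μ _ g Q hsrc
  refine ⟨fun i => ?_, fun U hU => ?_, ?_⟩
  · refine condEntropy_eq_zero _ _ fun ω ω' h => ?_
    rw [Prod.mk.injEq] at h
    rw [← sub_eq_zero, LinearScheme.message, LinearScheme.message, ← map_sub]
    refine henc i _ (fun k hk => ?_) fun V hV => ?_
    · exact sub_eq_zero.2 (congrFun h.1 ⟨k, hk⟩)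
    · exact sub_eq_zero.2 (congrFun h.2 ⟨V, hV⟩)
  · refine condEntropy_eq_zero _ _ fun ω ω' h => ?_
    exact (hdec U hU (fun k => g k ω, fun V => Q V ω) (fun k => g k ω', fun V => Q V ω')
      fun i hi => congrFun h ⟨i, hi⟩).1
  · -- The messages of a single set of `Nr` servers already recover the padded keys.
    obtain ⟨U, -, hU⟩ := Finset.exists_subset_card_eq
      (s := (Finset.univ : Finset (Fin N))) (n := Nr) (by simpa using hNr)
    have hQ : Measurable fun ω V => Q V ω := measurable_pi_iff.2 hsrc.measurable_key
    have hG : Measurable fun ω k => g k ω := measurable_pi_iff.2 hsrc.measurable_gradient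
    refine condMutualInfo_eq_zero_of_oneTimePad _ μ hQ hG hsrc.indep_gradients_keys
      (c := ∏ _V : KeyGroup N S, 1 / (Fintype.card F : ℝ) ^ C.keyLen) (fun q => ?_) f
      (fun x => ∑ k, x k) _ fun ω ω' h => ⟨fun e => ?_, fun e => ?_⟩
    · have h1 : (fun ω V => Q V ω) ⁻¹' {q} = ⋂ V ∈ Finset.univ, Q V ⁻¹' {q V} := by
        ext ω
        simp [funext_iff]
      rw [h1, measureReal_def, hsrc.indep_keys.measure_inter_preimage_eq_mul Finset.univ
        fun V _ => measurableSet_singleton (q V), ENNReal.toReal_prod]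
      exact Finset.prod_congr rfl fun V _ => hsrc.uniform_key V (q V)
    · exact (hdec U hU (fun k => g k ω, fun V => Q V ω) (fun k => g k ω', fun V => Q V ω')
        fun i _ => congrFun e i).2
    · exact funext fun i => hmsg (fun k => g k ω, fun V => Q V ω)
        (fun k => g k ω', fun V => Q V ω') h e i

theorem nonempty_linearEquiv_pi_extension (F E : Type*) [Field F] [Field E] [Algebra F E]
    [Module.Finite F E] (d : ℕ) :
    Nonempty ((Fin (Module.finrank F E * d) → F) ≃ₗ[F] (Fin d → E)) := by
  refine ⟨LinearEquiv.ofFinrankEq _ _ ?_⟩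
  rw [Module.finrank_fin_fun, Module.finrank_pi_fintype]
  simp [mul_comm]

/-- The scheme obtained from the coding matrices over an extension field `E` of `F`, whose elements
are read as blocks of `finrank F E` symbols of `F`. -/
theorem exists_secureGradientCode {F : Type u} [Field F] [Fintype F] [MeasurableSpace F]
    [DiscreteMeasurableSpace F] (E : Type) [Field E] [Finite E] [Algebra F E] [Module.Finite F E]
    {K N S Nr a b n : ℕ} (ha : 0 < a) (hab : a + (N - b).choose S = N.choose S)
    (hn : n + N.choose S * b = Nr * a) (hNr : Nr ≤ N) (hb : b ≤ N) (hS : N < S + Nr)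
    (hE : 2 ^ N * (Nr * a) + 2 ^ N * (b * a) < Nat.card E)
    (D : Fin K → Finset (Fin N)) (hD : ∀ k, N - b ≤ (D k).card) :
    ∃ C : LinearScheme F K N S (Module.finrank F E * n),
      LinearScheme.IsSecureGradientCode.{u, w} C D Nr ∧
        ∀ i, C.msgLen i = Module.finrank F E * a := by
  obtain ⟨A, B, hB, hdec, hΛ⟩ := exists_coding_matrices ha hab hn hS E hE
  have hT : ∀ k, ∃ T : Finset (Fin N), (D k)ᶜ ⊆ T ∧ T.card = b := by
    intro k
    refine Finset.exists_superset_card_eq ?_ (by simpa using hb)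
    rw [Finset.card_compl, Fintype.card_fin]
    have := hD k
    omega
  choose T hDT hTb using hT
  -- `Λ k` is chosen so that gradient `k` cancels in the messages of the servers that lack it.
  choose Λ hΛ using fun k => hΛ (T k) (hTb k)
  obtain ⟨φ⟩ := nonempty_linearEquiv_pi_extension F E n
  obtain ⟨ψ⟩ := nonempty_linearEquiv_pi_extension F E b
  obtain ⟨χ⟩ := nonempty_linearEquiv_pi_extension F E a
  let pad (g : Fin K → Fin (Module.finrank F E * n) → F) (V : KeyGroup N S) :
      Fin (Module.finrank F E * b) → F :=
    ψ.symm fun β => ∑ k, (Λ k).mulVec (φ (g k)) (V, β)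
  have pad_add : ∀ g g', pad (g + g') = pad g + pad g' := by
    intro g g'
    ext1 V
    simp only [pad, Pi.add_apply]
    rw [← map_add]
    congr 1
    ext β
    simp [Matrix.mulVec_add, Finset.sum_add_distrib]
  have pad_smul : ∀ (c : F) g, pad (c • g) = c • pad g := by
    intro c g
    ext1 V
    simp only [pad, Pi.smul_apply]
    rw [← map_smul]
    congr 1
    ext β
    simp [Matrix.mulVec_smul, Finset.smul_sum]
  let key (q : KeyGroup N S → Fin (Module.finrank F E * b) → F) : KeyGroup N S × Fin b → E :=
    fun p => ψ (q p.1) p.2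
  have key_add : ∀ q q', key (q + q') = key q + key q' := fun q q' => by ext p; simp [key]
  have key_smul : ∀ (c : F) q, key (c • q) = c • key q := fun c q => by ext p; simp [key]
  have key_pad : ∀ g, key (pad g) = ∑ k, (Λ k).mulVec (φ (g k)) := by
    intro g
    ext p
    simp [key, pad, Finset.sum_apply]
  let word (p : (Fin K → Fin (Module.finrank F E * n) → F) ×
      (KeyGroup N S → Fin (Module.finrank F E * b) → F)) : Fin N × Fin a → E :=
    A.mulVec (φ (∑ k, p.1 k)) + B.mulVec (key (p.2 + pad p.1))
  let C : LinearScheme F K N S (Module.finrank F E * n) :=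
    { keyLen := Module.finrank F E * b
      msgLen := fun _ => Module.finrank F E * a
      encode := fun i =>
        { toFun := fun p => χ.symm fun α => word p (i, α)
          map_add' := fun p p' => by
            rw [← map_add]
            congr 1
            ext α
            simp only [word, Prod.fst_add, Prod.snd_add, pad_add, key_add, Pi.add_apply,
              Finset.sum_add_distrib, map_add, Matrix.mulVec_add]
            ring
          map_smul' := fun c p => by
            rw [RingHom.id_apply, ← map_smul]
            congr 1
            ext α
            simp only [word, Prod.smul_fst, Prod.smul_snd, pad_smul, ← smul_add, key_smul,
              Pi.smul_apply, Pi.add_apply, ← Finset.smul_sum, map_smul, Matrix.mulVec_smul] } }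
  have hC : ∀ i p p', C.encode i p = C.encode i p' ↔ ∀ α, word p (i, α) = word p' (i, α) := by
    intro i p p'
    rw [← funext_iff]
    exact χ.symm.injective.eq_iff
  refine ⟨C, C.isSecureGradientCode_of hNr D pad ?_ ?_ ?_, fun _ => rfl⟩
  · intro i p hg hq
    have h0 : ∀ α, word p (i, α) = 0 := by
      intro α
      have hgrad : word p = ∑ k, (A + B * Λ k).mulVec (φ (p.1 k)) + B.mulVec (key p.2) := by
        simp only [word, key_add, key_pad, map_sum, Matrix.mulVec_add, Matrix.mulVec_sum,
          Matrix.add_mulVec, ← Matrix.mulVec_mulVec, Finset.sum_add_distrib]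
        abel
      rw [hgrad, Pi.add_apply, Finset.sum_apply]
      have h1 : ∀ k, (A + B * Λ k).mulVec (φ (p.1 k)) (i, α) = 0 := by
        intro k
        by_cases hk : i ∈ D k
        · rw [hg k hk, map_zero, Matrix.mulVec_zero, Pi.zero_apply]
        · rw [Matrix.mulVec, hΛ k i (hDT k (Finset.mem_compl.2 hk)) α, zero_dotProduct]
      have h2 : B.mulVec (key p.2) (i, α) = 0 := by
        refine Finset.sum_eq_zero fun c _ => ?_
        by_cases hc : i ∈ c.1.1
        · simp [key, hq c.1 hc]
        · exact mul_eq_zero_of_left (hB i α c hc) _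
      simp [h1, h2]
    change χ.symm (fun α => word p (i, α)) = 0
    rw [show (fun α => word p (i, α)) = 0 from funext h0, map_zero]
  · intro U hU p p' h
    have h1 := hdec U hU (φ (∑ k, p.1 k) - φ (∑ k, p'.1 k))
      (key (p.2 + pad p.1) - key (p'.2 + pad p'.1)) fun i hi α => by
        have := (hC i p p').1 (h i hi) α
        rw [Matrix.mulVec_sub, Matrix.mulVec_sub, sub_add_sub_comm]
        exact sub_eq_zero.2 this
    refine ⟨φ.injective (sub_eq_zero.1 h1.1), funext fun V => ψ.injective (funext fun β => ?_)⟩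
    exact congrFun (sub_eq_zero.1 h1.2) (V, β)
  · intro p p' hsum hkey i
    refine (hC i p p').2 fun α => ?_
    simp only [word, hsum]
    rw [show p.2 + pad p.1 = p'.2 + pad p'.1 from hkey]

/-! ### Positivity of the normalized gradient length -/

theorem descFactorial_succ_lt {m n j : ℕ} (h : m < n) (hj : j + 1 ≤ n) :
    m.descFactorial (j + 1) < n.descFactorial (j + 1) := by
  obtain ⟨n, rfl⟩ := Nat.exists_eq_add_one_of_ne_zero (by omega : n ≠ 0)
  have hpos : 0 < n.descFactorial j := Nat.descFactorial_pos.2 (by omega)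
  rw [Nat.succ_descFactorial_succ]
  rcases m with _ | m
  · rw [Nat.zero_descFactorial_succ]; positivity
  · rw [Nat.succ_descFactorial_succ]
    calc (m + 1) * m.descFactorial j ≤ (m + 1) * n.descFactorial j :=
          Nat.mul_le_mul_left _ (Nat.descFactorial_le j (by omega))
      _ < (n + 1) * n.descFactorial j := Nat.mul_lt_mul_of_pos_right (by omega) hpos

/-- In `M (M - 1) ⋯ (M - S + 1) / (N (N - 1) ⋯ (N - S + 1))` the factor `(M - t) / (N - t)` is
present and another factor is less than one. -/
theorem choose_mul_sub_lt {M N S t : ℕ} (htM : t < M) (hMN : M < N) (hSN : S ≤ N)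
    (htS : t + 2 ≤ S) : M.choose S * (N - t) < N.choose S * (M - t) := by
  have hsplit : ∀ x, t < x → x.descFactorial S =
      (x - (t + 1)).descFactorial (S - (t + 1)) * ((x - t) * x.descFactorial t) := by
    intro x _
    rw [← Nat.descFactorial_succ, Nat.descFactorial_mul_descFactorial (by omega)]
  have hS : S - (t + 1) = (S - (t + 2)) + 1 := by omega
  have h1 : (M - (t + 1)).descFactorial (S - (t + 1)) <
      (N - (t + 1)).descFactorial (S - (t + 1)) := by
    rw [hS]
    exact descFactorial_succ_lt (by omega) (by omega)
  have h2 : M.descFactorial t ≤ N.descFactorial t := Nat.descFactorial_le t hMN.le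
  have h3 : 0 < N.descFactorial t := Nat.descFactorial_pos.2 (by omega)
  have h4 : 0 < (M - t) * (N - t) := Nat.mul_pos (by omega) (by omega)
  have key : M.descFactorial S * (N - t) < N.descFactorial S * (M - t) := by
    rw [hsplit M htM, hsplit N (htM.trans hMN)]
    have := Nat.mul_lt_mul_of_lt_of_le h1 h2 h3
    calc _ = (M - (t + 1)).descFactorial (S - (t + 1)) * M.descFactorial t *
          ((M - t) * (N - t)) := by ring
      _ < (N - (t + 1)).descFactorial (S - (t + 1)) * N.descFactorial t *
          ((M - t) * (N - t)) := Nat.mul_lt_mul_of_pos_right this h4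
      _ = _ := by ring
  rw [Nat.descFactorial_eq_factorial_mul_choose, Nat.descFactorial_eq_factorial_mul_choose,
    mul_assoc, mul_assoc] at key
  exact lt_of_mul_lt_mul_left' key

/-! ### Field extensions -/

theorem exists_extension_of_finrank (F : Type*) [Field F] [Finite F] {m : ℕ} (hm : 1 ≤ m) :
    ∃ (E : Type) (_ : Field E) (_ : Finite E) (_ : Algebra F E) (_ : Module.Finite F E),
      Module.finrank F E = m := by
  have : NeZero m := ⟨by omega⟩
  have : Fact (ringChar F).Prime := ⟨CharP.char_is_prime F _⟩
  exact ⟨FiniteField.Extension F (ringChar F) m, inferInstance, inferInstance, inferInstance,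
    inferInstance, FiniteField.finrank_extension F (ringChar F) m⟩

end SecureGradientCoding

theorem theorem1 (K N Nr M S : ℕ) (hNr : Nr ≤ N) (hMN : M < N) (hM : N < Nr + M)
    (hSN : S ≤ N) (hS : N + 2 ≤ S + Nr) :
    ∃ q₀ : ℕ, ∀ (F : Type u) [Field F] [Fintype F] [MeasurableSpace F]
      [DiscreteMeasurableSpace F] (m : ℕ), 1 ≤ m → q₀ ≤ Fintype.card F ^ m →
      ∀ D : Fin K → Finset (Fin N), (∀ k, M ≤ (D k).card) →
        ∃ L : ℕ, 0 < L ∧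
          (L : ℤ) = m * (((N.choose S : ℤ) - M.choose S) * Nr - N.choose S * ((N : ℤ) - M)) ∧
          ∃ C : SecureGradientCoding.LinearScheme F K N S L,
            SecureGradientCoding.LinearScheme.IsSecureGradientCode.{u, w} C D Nr ∧
            C.commCost =
              ((N.choose S : ℝ) - M.choose S) /
                (((N.choose S : ℝ) - M.choose S) * Nr - N.choose S * ((N : ℝ) - M)) := by
  obtain ⟨t, ht⟩ := Nat.exists_eq_add_of_le hNr
  obtain ⟨b, hb⟩ := Nat.exists_eq_add_of_le hMN.le
  obtain ⟨a, hab⟩ := Nat.exists_eq_add_of_le (Nat.choose_le_choose S hMN.le)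
  have hlt : N.choose S * b < Nr * a := by
    have h := SecureGradientCoding.choose_mul_sub_lt (M := M) (N := N) (S := S) (t := t)
      (by omega) hMN hSN (by omega)
    have h1 : M - t + b = Nr := by omega
    rw [show N - t = Nr by omega] at h
    have h2 : N.choose S * Nr = M.choose S * Nr + Nr * a := by rw [hab]; ring
    have h3 : N.choose S * Nr = N.choose S * (M - t) + N.choose S * b := by rw [← h1]; ring
    omega
  obtain ⟨n, hn⟩ := Nat.exists_eq_add_of_le hlt.le
  have hn0 : 0 < n := by omega
  have ha : 0 < a := Nat.pos_of_mul_pos_left (by omega : 0 < Nr * a)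
  refine ⟨2 ^ N * (Nr * a) + 2 ^ N * (b * a) + 1, ?_⟩
  intro F _ _ _ _ m hm hq D hD
  obtain ⟨E, _, _, _, _, rfl⟩ := SecureGradientCoding.exists_extension_of_finrank F hm
  rw [← Nat.card_eq_fintype_card, ← Module.natCard_eq_pow_finrank (K := F) (V := E)] at hq
  obtain ⟨C, hC, hlen⟩ := SecureGradientCoding.exists_secureGradientCode.{u, w} (F := F)
    (n := n) E ha
    (show a + (N - b).choose S = N.choose S by rw [show N - b = M by omega]; omega)
    (by omega) hNr (by omega) (by omega) (by omega) D
    (fun k => (show N - b = M by omega) ▸ hD k)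
  refine ⟨Module.finrank F E * n, by positivity, ?_, C, hC, ?_⟩
  · have hnZ : (Nr : ℤ) * a = N.choose S * b + n := by exact_mod_cast hn
    have habZ : (N.choose S : ℤ) = M.choose S + a := by exact_mod_cast hab
    have hbZ : (N : ℤ) = M + b := by exact_mod_cast hb
    push_cast
    rw [show (N : ℤ) - M = b by omega, show (N.choose S : ℤ) - M.choose S = a by omega]
    rw [show (n : ℤ) = a * Nr - N.choose S * b by rw [mul_comm (a : ℤ)]; omega]
  · have hnR : (Nr : ℝ) * a = N.choose S * b + n := by exact_mod_cast hn
    have habR : (N.choose S : ℝ) - M.choose S = a := by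
      rw [hab]; push_cast; ring
    have hbR : (N : ℝ) - M = b := by rw [hb]; push_cast; ring
    have : Nonempty (Fin N) := ⟨⟨0, by omega⟩⟩
    have hm0 : (Module.finrank F E : ℝ) ≠ 0 := Nat.cast_ne_zero.2 (by omega)
    rw [SecureGradientCoding.LinearScheme.commCost, habR, hbR,
      show (a : ℝ) * Nr - N.choose S * b = n by linarith]
    simp only [hlen, ciSup_const]
    push_cast
    exact mul_div_mul_left _ _ hm0
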